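/- **Proposition 4.1.** Work in $\mathbb R^n$ with volume $|\cdot|$ and spherical measure $\sigma$ on $S^{n-1}$. Let $\mathcal K_0$ be the set of compact convex sets containing the origin in their interior; for $K\in\mathcal K_0$ let $h_K(u)=\max_{x\in K}\langle x,u\rangle$, $\rho_K(u)=\max\{t\ge 0: tu\in K\}$, $K^\circ=\{x:\langle x,y\rangle\le 1\ \forall y\in K\}$, and let $S(K,\cdot)$ be the surface area measure of $K$, i.e. the finite Borel measure on $S^{n-1}$ with $\lim_{\varepsilon\to0^+}\frac{|K+\varepsilon L|-|K|}{\varepsilon}=\int_{S^{n-1}} h_L\,dS(K,\cdot)$ for all $L\in\mathcal K_0$. Let $\mathcal F_0$ be the set of $K\in\mathcal K_0$ for which $S(K,\cdot)$ is absolutely continuous with respect to $\sigma$, with density $f_K$ (the curvature function), and put $f_p(K,u)=h_K(u)^{1-p}f_K(u)$. For $\mathbf K=(K_1,\dots,K_n)\in\mathcal F_0^n$, $\mathbf L=(L_1,\dots,L_n)\in\mathcal K_0^n$ and $p\in\mathbb R$ let $$V_p(\mathbf K;\mathbf L)=\frac1n\int_{S^{n-1}}\prod_{i=1}^n\big[h_{L_i}(u)^p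 f_p(K_i,u)\big]^{1/n}d\sigma(u),\qquad \tilde V(\mathbf L^\circ)=\frac1n\int_{S^{n-1}}\prod_{i=1}^n\rho_{L_i^\circ}(u)\,d\sigma(u).$$ For $p=0$ set $G_0^{(\alpha)}(\mathbf K)=\int_{S^{n-1}}\prod_{i=1}^n[f_{K_i}(u)h_{K_i}(u)]^{1/n}d\sigma(u)$, $\alpha=1,2,3$. For $p>0$ set $$G_p^{(1)}(\mathbf K)=\inf_{L\in\mathcal K_0}\Big\{nV_p(\mathbf K;L,\dots,L)^{\frac n{n+p}}|L^\circ|^{\frac p{n+p}}\Big\},$$ $$G_p^{(2)}(\mathbf K)=\inf_{\mathbf L\in\mathcal K_0^n}\Big\{nV_p(\mathbf K;\mathbf L)^{\frac n{n+p}}\prod_{i=1}^n|L_i^\circ|^{\frac p{(n+p)n}}\Big\},\qquad G_p^{(3)}(\mathbf K)=\inf_{\mathbf L\in\mathcal K_0^n}\Big\{nV_p(\mathbf K;\mathbf L)^{\frac n{n+p}}\tilde V(\mathbf L^\circ)^{\frac p{n+p}}\Big\},$$ and for $-n\ne p<0$ define $G_p^{(\alpha)}$ by the same formulas with $\sup$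 in place of $\inf$. Infima and suprema are taken in $[0,\infty]$ (with $0^a=\infty$ for $a<0$). Let $K_1,\dots,K_n\in\mathcal F_0$ and $\phi\in GL(n)$. Then $\phi K_1,\dots,\phi K_n\in\mathcal F_0$, and for all $\alpha=1,2,3$ and all real $p\neq -n$, $$G_p^{(\alpha)}(\phi K_1,\dots,\phi K_n)=|\det\phi|^{\frac{n-p}{n+p}}\,G_p^{(\alpha)}(K_1,\dots,K_n).$$ In particular, if $\phi\in SL(n)$, then $G_p^{(\alpha)}(\phi K_1,\dots,\phi K_n)=G_p^{(\alpha)}(K_1,\dots,K_n)$. -/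

import Mathlib

open MeasureTheory Filter Topology Set
open scoped ENNReal Pointwise

noncomputable section

namespace LpGeominimal

/-- Euclidean space `ℝⁿ`. -/
abbrev Rn (n : ℕ) : Type := EuclideanSpace ℝ (Fin n)

/-- The unit sphere `S^{n-1}` of `ℝⁿ`. -/
abbrev Sph (n : ℕ) : Type := Metric.sphere (0 : Rn n) 1

/-- The spherical measure `σ` on `S^{n-1}` (total mass `n · ω_n`). -/
def sigma (n : ℕ) : Measure (Sph n) := (volume : Measure (Rn n)).toSphere

/-- `𝒦₀`: the convex bodies in `ℝⁿ` that contain the origin in their interiors. -/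
def KZero (n : ℕ) : Set (Set (Rn n)) :=
  {K | IsCompact K ∧ Convex ℝ K ∧ (0 : Rn n) ∈ interior K}

/-- The support function `h_K(u) = max {⟨x, u⟩ : x ∈ K}`. -/
def supportFun {n : ℕ} (K : Set (Rn n)) (u : Rn n) : ℝ :=
  sSup ((fun x : Rn n => inner ℝ x u) '' K)

/-- The radial function `ρ_L(u) = max {t ≥ 0 : t u ∈ L}`. -/
def radialFun {n : ℕ} (L : Set (Rn n)) (u : Rn n) : ℝ :=
  sSup {t : ℝ | 0 ≤ t ∧ t • u ∈ L}

/-- The polar body `K° = {x : ⟨x, y⟩ ≤ 1 for all y ∈ K}`. -/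
def polar {n : ℕ} (K : Set (Rn n)) : Set (Rn n) :=
  {x | ∀ y ∈ K, inner ℝ x y ≤ 1}

/-- `S` is the (classical, Aleksandrov / Fenchel-Jessen) surface area measure of `K`: the finite
Borel measure on the sphere that represents the first variation of volume under Minkowski
addition, `lim_{ε → 0+} (|K + ε L| - |K|) / ε = ∫ h_L dS` for all `L ∈ 𝒦₀`
(both sides are `n V₁(K, L)`). -/
def IsSurfaceAreaMeasure {n : ℕ} (K : Set (Rn n)) (S : Measure (Sph n)) : Prop :=
  IsFiniteMeasure S ∧
    ∀ L ∈ KZero n,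
      Tendsto (fun ε : ℝ => (volume.real (K + ε • L) - volume.real K) / ε) (𝓝[>] 0)
        (𝓝 (∫ u : Sph n, supportFun L u ∂S))

open Classical in
/-- The surface area measure `S(K, ·)`. -/
def surfaceAreaMeasure {n : ℕ} (K : Set (Rn n)) : Measure (Sph n) :=
  if h : ∃ S : Measure (Sph n), IsSurfaceAreaMeasure K S then h.choose else 0

/-- `ℱ₀`: the bodies in `𝒦₀` with a curvature function, that is, whose surface area measure is
absolutely continuous with respect to the spherical measure. -/
def FZero (n : ℕ) : Set (Set (Rn n)) :=
  {K | K ∈ KZero n ∧ ∃ S : Measure (Sph n), IsSurfaceAreaMeasure K S ∧ S ≪ sigma n}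

/-- The curvature function `f_K`, the density of `S(K, ·)` with respect to `σ`. -/
def curvatureFun {n : ℕ} (K : Set (Rn n)) (u : Sph n) : ℝ :=
  ((surfaceAreaMeasure K).rnDeriv (sigma n) u).toReal

/-- The `L_p` curvature function `f_p(K, u) = h_K(u)^{1-p} f_K(u)`. -/
def lpCurvatureFun {n : ℕ} (p : ℝ) (K : Set (Rn n)) (u : Sph n) : ℝ :=
  supportFun K u ^ (1 - p) * curvatureFun K u

/-- `V_p(K; Q) = (1/n) ∫ ∏ᵢ [h_{Qᵢ}^p f_p(Kᵢ, ·)]^{1/n} dσ`; the integrand is nonnegative. -/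
def mixedVp {n : ℕ} (p : ℝ) (K Q : Fin n → Set (Rn n)) : ℝ≥0∞ :=
  (n : ℝ≥0∞)⁻¹ * ∫⁻ u : Sph n,
    ENNReal.ofReal (∏ i, (supportFun (Q i) u ^ p * lpCurvatureFun p (K i) u) ^ (1 / (n : ℝ)))
      ∂(sigma n)

/-- The dual mixed volume `Ṽ(L) = (1/n) ∫ ∏ᵢ ρ_{Lᵢ} dσ`. -/
def dualMixedVolume {n : ℕ} (L : Fin n → Set (Rn n)) : ℝ≥0∞ :=
  (n : ℝ≥0∞)⁻¹ * ∫⁻ u : Sph n, ENNReal.ofReal (∏ i, radialFun (L i) u) ∂(sigma n)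

/-- `G_0^{(α)}(K) = ∫ ∏ᵢ [f_{Kᵢ} h_{Kᵢ}]^{1/n} dσ`, for every `α`. -/
def geominimalZero {n : ℕ} (K : Fin n → Set (Rn n)) : ℝ≥0∞ :=
  ∫⁻ u : Sph n,
    ENNReal.ofReal (∏ i, (curvatureFun (K i) u * supportFun (K i) u) ^ (1 / (n : ℝ)))
      ∂(sigma n)

/-- The functional optimized in `G_p^{(1)}`: `n V_p(K; L, …, L)^{n/(n+p)} |L°|^{p/(n+p)}`.
Here and below the values lie in `[0, ∞]`, with `0 ^ a = ∞` for `a < 0`. -/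
def functionalOne {n : ℕ} (p : ℝ) (K : Fin n → Set (Rn n)) (L : Set (Rn n)) : ℝ≥0∞ :=
  n * mixedVp p K (fun _ => L) ^ ((n : ℝ) / (n + p)) * volume (polar L) ^ (p / (n + p))

/-- The functional optimized in `G_p^{(2)}`:
`n V_p(K; L)^{n/(n+p)} ∏ᵢ |Lᵢ°|^{p/((n+p)n)}`. -/
def functionalTwo {n : ℕ} (p : ℝ) (K L : Fin n → Set (Rn n)) : ℝ≥0∞ :=
  n * mixedVp p K L ^ ((n : ℝ) / (n + p)) * ∏ i, volume (polar (L i)) ^ (p / ((n + p) * n))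

/-- The functional optimized in `G_p^{(3)}`: `n V_p(K; L)^{n/(n+p)} Ṽ(L°)^{p/(n+p)}`. -/
def functionalThree {n : ℕ} (p : ℝ) (K L : Fin n → Set (Rn n)) : ℝ≥0∞ :=
  n * mixedVp p K L ^ ((n : ℝ) / (n + p)) *
    dualMixedVolume (fun i => polar (L i)) ^ (p / (n + p))

/-- The mixed `L_p` geominimal surface area `G_p^{(1)}(K₁, …, K_n)`. -/
def geominimalOne {n : ℕ} (p : ℝ) (K : Fin n → Set (Rn n)) : ℝ≥0∞ :=
  if p = 0 then geominimalZero K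
  else if 0 < p then ⨅ L ∈ KZero n, functionalOne p K L
  else ⨆ L ∈ KZero n, functionalOne p K L

/-- The mixed `L_p` geominimal surface area `G_p^{(2)}(K₁, …, K_n)`. -/
def geominimalTwo {n : ℕ} (p : ℝ) (K : Fin n → Set (Rn n)) : ℝ≥0∞ :=
  if p = 0 then geominimalZero K
  else if 0 < p then ⨅ L ∈ {L : Fin n → Set (Rn n) | ∀ i, L i ∈ KZero n}, functionalTwo p K L
  else ⨆ L ∈ {L : Fin n → Set (Rn n) | ∀ i, L i ∈ KZero n}, functionalTwo p K L

/-- The mixed `L_p` geominimal surface area `G_p^{(3)}(K₁, …, K_n)`. -/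
def geominimalThree {n : ℕ} (p : ℝ) (K : Fin n → Set (Rn n)) : ℝ≥0∞ :=
  if p = 0 then geominimalZero K
  else if 0 < p then ⨅ L ∈ {L : Fin n → Set (Rn n) | ∀ i, L i ∈ KZero n}, functionalThree p K L
  else ⨆ L ∈ {L : Fin n → Set (Rn n) | ∀ i, L i ∈ KZero n}, functionalThree p K L

/-- `G_p^{(α)}(K₁, …, K_n)`; the index `α = 1, 2, 3` is represented by `0, 1, 2 : Fin 3`. -/
def geominimal {n : ℕ} (α : Fin 3) (p : ℝ) (K : Fin n → Set (Rn n)) : ℝ≥0∞ :=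
  ![geominimalOne p K, geominimalTwo p K, geominimalThree p K] α

end LpGeominimal

end

/-! Each optimized functional is equivariant: replacing all bodies `K i` and `L i` by their images
under `φ` multiplies it by `|det φ| ^ ((n - p) / (n + p))`. Since `L ↦ φ L` permutes `KZero n`, the
infimum or supremum scales by the same factor.

For `V_p`, substitute `v = φ⁻ᵀu / ‖φ⁻ᵀu‖` on the sphere. With `r = ‖φ⁻ᵀu‖`, the Jacobian is `|det
φ|⁻¹ r⁻ⁿ`, while `h_{φK}(v) = r⁻¹ h_K(u)` and, almost everywhere, `f_{φK}(v) = (det φ)² rⁿ⁺¹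
f_K(u)`. All powers of `r` cancel, so `V_p` scales by `|det φ|` (`mixedVp_image`). Polar volumes and
the dual mixed volume scale by `|det φ|⁻¹`.

The law for `f` comes from the first variation of volume: `φK + εL = φ(K + ε φ⁻¹L)` exhibits a
measure representing the variation of `φK` (`IsSurfaceAreaMeasure.image`). It is the surface area
measure because support functions determine a finite measure
(`measure_eq_of_integral_supportFun_eq`). -/

namespace LpGeominimal

/-! ### Support functions of sums, hulls and balls -/

section SupportFunction

variable {n : ℕ} {K L : Set (Rn n)} {u x : Rn n}

theorem bddAbove_inner_image (hK : IsCompact K) (u : Rn n) :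
    BddAbove ((fun x : Rn n => inner ℝ x u) '' K) :=
  (hK.image (by fun_prop)).bddAbove

theorem inner_le_supportFun (hK : IsCompact K) (hx : x ∈ K) (u : Rn n) :
    inner ℝ x u ≤ supportFun K u :=
  le_csSup (bddAbove_inner_image hK u) (mem_image_of_mem _ hx)

theorem supportFun_le (hK : K.Nonempty) {c : ℝ} (h : ∀ x ∈ K, inner ℝ x u ≤ c) :
    supportFun K u ≤ c :=
  csSup_le (hK.image _) (by rintro _ ⟨x, hx, rfl⟩; exact h x hx)

theorem continuous_supportFun (hK : IsCompact K) : Continuous (supportFun K) :=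
  hK.continuous_sSup (f := fun u x : Rn n => inner ℝ x u) (by fun_prop)

theorem zero_mem_of_mem_KZero (hK : K ∈ KZero n) : (0 : Rn n) ∈ K := interior_subset hK.2.2

theorem supportFun_nonneg (hK : K ∈ KZero n) (u : Rn n) : 0 ≤ supportFun K u := by
  simpa using inner_le_supportFun hK.1 (zero_mem_of_mem_KZero hK) u

theorem supportFun_smul_vec (K : Set (Rn n)) {c : ℝ} (hc : 0 ≤ c) (u : Rn n) :
    supportFun K (c • u) = c * supportFun K u := by
  have : (fun x : Rn n => inner ℝ x (c • u)) '' K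
      = c • ((fun x : Rn n => inner ℝ x u) '' K) := by
    ext t
    simp [mem_smul_set, real_inner_smul_right]
  rw [supportFun, this, Real.sSup_smul_of_nonneg hc, smul_eq_mul, supportFun]

theorem supportFun_image (φ : Rn n →ₗ[ℝ] Rn n) (K : Set (Rn n)) (u : Rn n) :
    supportFun (φ '' K) u = supportFun K (LinearMap.adjoint φ u) := by
  simp only [supportFun, image_image, LinearMap.adjoint_inner_right]

theorem add_mem_KZero (hK : K ∈ KZero n) (hL : L ∈ KZero n) : K + L ∈ KZero n := by
  refine ⟨hK.1.add hL.1, hK.2.1.add hL.2.1, interior_mono (fun x hx => ?_) hK.2.2⟩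
  exact ⟨x, hx, 0, zero_mem_of_mem_KZero hL, add_zero x⟩

theorem supportFun_add (hK : K ∈ KZero n) (hL : L ∈ KZero n) (u : Rn n) :
    supportFun (K + L) u = supportFun K u + supportFun L u := by
  have hKL := add_mem_KZero hK hL
  have hK0 : K.Nonempty := ⟨0, zero_mem_of_mem_KZero hK⟩
  have hL0 : L.Nonempty := ⟨0, zero_mem_of_mem_KZero hL⟩
  apply le_antisymm
  · refine supportFun_le (hK0.add hL0) ?_
    rintro _ ⟨x, hx, y, hy, rfl⟩
    rw [inner_add_left]
    exact add_le_add (inner_le_supportFun hK.1 hx u) (inner_le_supportFun hL.1 hy u)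
  · rw [← le_sub_iff_add_le]
    refine supportFun_le hK0 fun x hx => ?_
    rw [le_sub_comm]
    refine supportFun_le hL0 fun y hy => ?_
    have := inner_le_supportFun hKL.1 (add_mem_add hx hy) u
    rw [inner_add_left] at this
    linarith

/-- This body realizes the pointwise maximum of two support functions, which makes their differences
a lattice. Taking the closure reduces compactness to boundedness. -/
theorem closure_convexHull_union_mem_KZero (hK : K ∈ KZero n) (hL : L ∈ KZero n) :
    closure (convexHull ℝ (K ∪ L)) ∈ KZero n := by
  refine ⟨?_, (convex_convexHull ℝ _).closure, ?_⟩
  · exact (isBounded_convexHull.2 (hK.1.union hL.1).isBounded).isCompact_closure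
  · exact interior_mono
      ((subset_union_left.trans (subset_convexHull ℝ _)).trans subset_closure) hK.2.2

theorem supportFun_closure_convexHull_union (hK : K ∈ KZero n) (hL : L ∈ KZero n) (u : Rn n) :
    supportFun (closure (convexHull ℝ (K ∪ L))) u = max (supportFun K u) (supportFun L u) := by
  have hC := closure_convexHull_union_mem_KZero hK hL
  have hsub : K ∪ L ⊆ closure (convexHull ℝ (K ∪ L)) :=
    (subset_convexHull ℝ _).trans subset_closure
  apply le_antisymm
  · refine supportFun_le ⟨0, zero_mem_of_mem_KZero hC⟩ ?_
    have hclosed : IsClosed {x : Rn n | inner ℝ x u ≤ max (supportFun K u) (supportFun L u)} :=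
      isClosed_le (by fun_prop) continuous_const
    have hconv : Convex ℝ {x : Rn n | inner ℝ x u ≤ max (supportFun K u) (supportFun L u)} :=
      convex_halfSpace_le (f := fun x : Rn n => inner ℝ x u)
        ⟨fun x y => inner_add_left x y u, fun c x => real_inner_smul_left x u c⟩ _
    refine closure_minimal (convexHull_min ?_ hconv) hclosed
    rintro x (hx | hx)
    · exact (inner_le_supportFun hK.1 hx u).trans (le_max_left _ _)
    · exact (inner_le_supportFun hL.1 hx u).trans (le_max_right _ _)
  · apply max_le
    · exact supportFun_le ⟨0, zero_mem_of_mem_KZero hK⟩ fun x hx =>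
        inner_le_supportFun hC.1 (hsub (Or.inl hx)) u
    · exact supportFun_le ⟨0, zero_mem_of_mem_KZero hL⟩ fun x hx =>
        inner_le_supportFun hC.1 (hsub (Or.inr hx)) u

theorem closedBall_mem_KZero (c : Rn n) {r : ℝ} (hr : ‖c‖ < r) :
    Metric.closedBall c r ∈ KZero n := by
  refine ⟨isCompact_closedBall c r, convex_closedBall c r, ?_⟩
  exact interior_mono Metric.ball_subset_closedBall
    (by rw [Metric.isOpen_ball.interior_eq]; simpa using hr)

theorem supportFun_closedBall (c : Rn n) {r : ℝ} (hr : 0 ≤ r) (hu : ‖u‖ = 1) :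
    supportFun (Metric.closedBall c r) u = inner ℝ c u + r := by
  apply le_antisymm
  · refine supportFun_le (Metric.nonempty_closedBall.2 hr) fun x hx => ?_
    have h1 : inner ℝ (x - c) u ≤ ‖x - c‖ * ‖u‖ := real_inner_le_norm _ _
    rw [inner_sub_left, hu, mul_one] at h1
    rw [mem_closedBall_iff_norm] at hx
    linarith
  · have hmem : c + r • u ∈ Metric.closedBall c r := by
      simp [norm_smul, hu, abs_of_nonneg hr]
    have := inner_le_supportFun (isCompact_closedBall c r) hmem u
    simpa [inner_add_left, real_inner_smul_left, real_inner_self_eq_norm_sq, hu] using this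

end SupportFunction

/-! ### Uniqueness of the surface area measure -/

section Uniqueness

variable {n : ℕ}

/-- The differences of support functions of convex bodies, restricted to the sphere. -/
def supportDifferences (n : ℕ) : Set C(Sph n, ℝ) :=
  {f | ∃ A ∈ KZero n, ∃ B ∈ KZero n, ∀ u : Sph n, f u = supportFun A u - supportFun B u}

/-- Over a common subtrahend, `max (a - b) (c - d) = max (a + d) (c + b) - (b + d)`. -/
theorem sup_mem_supportDifferences {f g : C(Sph n, ℝ)} (hf : f ∈ supportDifferences n)
    (hg : g ∈ supportDifferences n) : f ⊔ g ∈ supportDifferences n := by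
  obtain ⟨A, hA, B, hB, hf⟩ := hf
  obtain ⟨C, hC, D, hD, hg⟩ := hg
  refine ⟨_, closure_convexHull_union_mem_KZero (add_mem_KZero hA hD) (add_mem_KZero hC hB),
    _, add_mem_KZero hB hD, fun u => ?_⟩
  rw [supportFun_closure_convexHull_union (add_mem_KZero hA hD) (add_mem_KZero hC hB),
    supportFun_add hA hD, supportFun_add hC hB, supportFun_add hB hD, ContinuousMap.sup_apply,
    hf, hg, ← max_sub_sub_right]
  congr 1 <;> ring

theorem neg_mem_supportDifferences {f : C(Sph n, ℝ)} (hf : f ∈ supportDifferences n) :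
    -f ∈ supportDifferences n := by
  obtain ⟨A, hA, B, hB, hf⟩ := hf
  exact ⟨B, hB, A, hA, fun u => by rw [ContinuousMap.neg_apply, hf]; ring⟩

theorem inf_mem_supportDifferences {f g : C(Sph n, ℝ)} (hf : f ∈ supportDifferences n)
    (hg : g ∈ supportDifferences n) : f ⊓ g ∈ supportDifferences n := by
  have := neg_mem_supportDifferences
    (sup_mem_supportDifferences (neg_mem_supportDifferences hf) (neg_mem_supportDifferences hg))
  convert! this using 1
  ext u
  simp [← min_neg_neg]

theorem affine_mem_supportDifferences (c : Rn n) (b : ℝ) (f : C(Sph n, ℝ))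
    (hf : ∀ u : Sph n, f u = inner ℝ c (u : Rn n) + b) : f ∈ supportDifferences n := by
  have hb := abs_nonneg b
  have hb' := neg_abs_le b
  have hc := norm_nonneg c
  -- The radii differ by `b`; their common part is large enough to keep the origin interior to both
  -- balls.
  refine ⟨Metric.closedBall c (‖c‖ + |b| + 1 + b), closedBall_mem_KZero c (by linarith),
    Metric.closedBall 0 (‖c‖ + |b| + 1), closedBall_mem_KZero 0 (by rw [norm_zero]; linarith),
    fun u => ?_⟩
  have hu : ‖(u : Rn n)‖ = 1 := by simp
  rw [supportFun_closedBall _ (by linarith) hu, supportFun_closedBall _ (by linarith) hu, hf]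
  simp only [inner_zero_left]
  ring

/-- Affine functions already interpolate two prescribed values: use the direction `x - y`, with
slope `a` fitted to the difference of the values. -/
theorem separatesPointsStrongly_supportDifferences :
    (supportDifferences n).SeparatesPointsStrongly := by
  intro v x y
  by_cases hxy : x = y
  · subst hxy
    exact ⟨.const _ (v x), affine_mem_supportDifferences 0 (v x) _ (by simp), rfl, rfl⟩
  set d : Rn n := (x : Rn n) - y with hd
  have hd0 : d ≠ 0 := sub_ne_zero.2 fun h => hxy (Subtype.ext h)
  have hdd : inner ℝ d (x : Rn n) - inner ℝ d (y : Rn n) ≠ 0 := by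
    rw [← inner_sub_right]
    exact inner_self_ne_zero.2 hd0
  set a := (v x - v y) / (inner ℝ d (x : Rn n) - inner ℝ d (y : Rn n)) with ha
  refine ⟨⟨fun u => inner ℝ (a • d) (u : Rn n) + (v x - inner ℝ (a • d) (x : Rn n)),
    by fun_prop⟩, affine_mem_supportDifferences _ _ _ fun u => rfl, by simp, ?_⟩
  have : a * (inner ℝ d (x : Rn n) - inner ℝ d (y : Rn n)) = v x - v y :=
    div_mul_cancel₀ _ hdd
  simp only [ContinuousMap.coe_mk, real_inner_smul_left]
  linarith

/-- The lattice form of Stone–Weierstrass applies, so closure under products is not needed. -/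
theorem closure_supportDifferences : closure (supportDifferences n) = univ :=
  ContinuousMap.sublattice_closure_eq_top _
    ⟨0, affine_mem_supportDifferences 0 0 _ (by simp)⟩
    (fun _ hf _ hg => inf_mem_supportDifferences hf hg)
    (fun _ hf _ hg => sup_mem_supportDifferences hf hg)
    separatesPointsStrongly_supportDifferences

theorem integrable_supportFun {S : Measure (Sph n)} [IsFiniteMeasure S] {L : Set (Rn n)}
    (hL : L ∈ KZero n) : Integrable (fun u : Sph n => supportFun L u) S :=
  ((continuous_supportFun hL.1).comp continuous_subtype_val).integrable_of_hasCompactSupport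
    (HasCompactSupport.of_compactSpace _)

/-- A finite measure on the sphere is determined by its integrals of support functions. -/
theorem measure_eq_of_integral_supportFun_eq {S T : Measure (Sph n)} [IsFiniteMeasure S]
    [IsFiniteMeasure T]
    (h : ∀ L ∈ KZero n, ∫ u : Sph n, supportFun L u ∂S = ∫ u : Sph n, supportFun L u ∂T) :
    S = T := by
  -- Integration factors through the continuous map from `C(Sph n, ℝ)` to `L¹(μ)`.
  have hcont : ∀ (μ : Measure (Sph n)) [IsFiniteMeasure μ],
      Continuous fun f : C(Sph n, ℝ) => ∫ u, f u ∂μ := fun μ _ =>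
    ((continuous_integral (μ := μ)).comp (ContinuousMap.toLp 1 μ ℝ).continuous).congr
      fun f => integral_congr_ae (ContinuousMap.coeFn_toLp (𝕜 := ℝ) μ f)
  have hclosed : IsClosed {f : C(Sph n, ℝ) | ∫ u, f u ∂S = ∫ u, f u ∂T} :=
    isClosed_eq (hcont S) (hcont T)
  have hsub : supportDifferences n ⊆ {f : C(Sph n, ℝ) | ∫ u, f u ∂S = ∫ u, f u ∂T} := by
    rintro f ⟨A, hA, B, hB, hf⟩
    simp only [mem_ofPred_eq, hf]
    rw [integral_sub (integrable_supportFun hA) (integrable_supportFun hB),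
      integral_sub (integrable_supportFun hA) (integrable_supportFun hB), h A hA, h B hB]
  refine ext_of_forall_integral_eq_of_IsFiniteMeasure fun f => ?_
  have : f.toContinuousMap ∈ closure (supportDifferences n) := by
    rw [closure_supportDifferences]; trivial
  exact closure_minimal hsub hclosed this

theorem IsSurfaceAreaMeasure.unique {K : Set (Rn n)} {S T : Measure (Sph n)}
    (hS : IsSurfaceAreaMeasure K S) (hT : IsSurfaceAreaMeasure K T) : S = T := by
  have := hS.1
  have := hT.1
  exact measure_eq_of_integral_supportFun_eq fun L hL =>
    tendsto_nhds_unique (hS.2 L hL) (hT.2 L hL)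

/-- Uniqueness makes the choice in `surfaceAreaMeasure` harmless: any representing measure computes
it. -/
theorem IsSurfaceAreaMeasure.surfaceAreaMeasure_eq {K : Set (Rn n)} {S : Measure (Sph n)}
    (hS : IsSurfaceAreaMeasure K S) : surfaceAreaMeasure K = S := by
  have h : ∃ S : Measure (Sph n), IsSurfaceAreaMeasure K S := ⟨S, hS⟩
  rw [surfaceAreaMeasure, dif_pos h]
  exact h.choose_spec.unique hS

end Uniqueness

/-! ### Change of variables on the sphere under a linear map -/

section SphereMap

variable {n : ℕ} (ψ : Rn n ≃ₗ[ℝ] Rn n)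

instance : IsFiniteMeasure (sigma n) := inferInstanceAs (IsFiniteMeasure (Measure.toSphere _))

theorem coe_sphere_ne_zero (u : Sph n) : (u : Rn n) ≠ 0 := by
  rw [← norm_ne_zero_iff]; simp

theorem norm_map_sphere_pos (u : Sph n) : 0 < ‖ψ u‖ := by
  rw [norm_pos_iff]
  exact (LinearEquiv.map_ne_zero_iff ψ).2 (coe_sphere_ne_zero u)

theorem continuous_linearEquiv : Continuous ψ :=
  LinearMap.continuous_of_finiteDimensional (ψ : Rn n →ₗ[ℝ] Rn n)

/-- The map of the sphere that sends `u` to the direction of `ψ u`. -/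
noncomputable def direction (u : Sph n) : Sph n :=
  ⟨‖ψ u‖⁻¹ • ψ u, by simp [norm_smul, (norm_map_sphere_pos ψ u).ne']⟩

@[simp]
theorem coe_direction (u : Sph n) : (direction ψ u : Rn n) = ‖ψ u‖⁻¹ • ψ u := rfl

theorem continuous_direction : Continuous (direction ψ) := by
  have h : Continuous fun u : Sph n => ψ u :=
    (continuous_linearEquiv ψ).comp continuous_subtype_val
  exact ((h.norm.inv₀ fun u => (norm_map_sphere_pos ψ u).ne').smul h).subtype_mk _

theorem direction_symm_direction (u : Sph n) : direction ψ.symm (direction ψ u) = u := by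
  have h := norm_map_sphere_pos ψ u
  apply Subtype.ext
  simp [norm_smul, smul_smul, h.ne']

/-- The homeomorphism of the sphere induced by an invertible linear map. -/
noncomputable def directionHomeomorph : Sph n ≃ₜ Sph n where
  toFun := direction ψ
  invFun := direction ψ.symm
  left_inv := direction_symm_direction ψ
  right_inv u := by simpa using direction_symm_direction ψ.symm u
  continuous_toFun := continuous_direction ψ
  continuous_invFun := continuous_direction ψ.symm

theorem coe_directionHomeomorph (u : Sph n) :
    (directionHomeomorph ψ u : Rn n) = ‖ψ u‖⁻¹ • ψ u := rfl

theorem measurable_norm_map_sphere : Measurable fun u : Sph n => ‖ψ u‖ :=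
  ((continuous_linearEquiv ψ).comp continuous_subtype_val).norm.measurable

/-- The star-shaped region `{r u : u ∈ A, 0 < r < a u}`. -/
noncomputable def radialRegion (A : Set (Sph n)) (a : Sph n → ℝ) : Set (Rn n) :=
  {x | ∃ u ∈ A, ∃ r : ℝ, 0 < r ∧ r < a u ∧ x = r • (u : Rn n)}

/-- Polar coordinates: the ray through `u` contributes `∫₀^{a u} rⁿ⁻¹ dr = (a u)ⁿ / n`. -/
theorem volume_radialRegion (hn : n ≠ 0) {A : Set (Sph n)} (hA : MeasurableSet A)
    {a : Sph n → ℝ} (ha : Measurable a) (ha0 : ∀ u, 0 < a u) :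
    volume (radialRegion A a) = ∫⁻ u in A, ENNReal.ofReal (a u ^ n / n) ∂(sigma n) := by
  have : NeZero n := ⟨hn⟩
  set R : Set (Sph n × Ioi (0 : ℝ)) := {p | p.1 ∈ A ∧ (p.2 : ℝ) < a p.1} with hR
  have hRm : MeasurableSet R :=
    (measurable_fst hA).inter
      (measurableSet_lt (measurable_subtype_coe.comp measurable_snd) (ha.comp measurable_fst))
  have hmp := (volume : Measure (Rn n)).measurePreserving_homeomorphUnitSphereProd
  have himage : radialRegion A a
      = Subtype.val '' (homeomorphUnitSphereProd (Rn n) ⁻¹' R) := by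
    rw [← Homeomorph.image_symm, image_image]
    ext x
    constructor
    · rintro ⟨u, hu, r, hr, hra, rfl⟩
      exact ⟨(u, ⟨r, hr⟩), ⟨hu, hra⟩, rfl⟩
    · rintro ⟨⟨u, ⟨r, hr⟩⟩, ⟨hu, hra⟩, rfl⟩
      exact ⟨u, hu, r, hr, hra, rfl⟩
  rw [himage, ← comap_subtype_coe_apply (measurableSet_singleton _).compl,
    hmp.measure_preimage hRm.nullMeasurableSet, Measure.prod_apply hRm, ← lintegral_indicator hA]
  refine lintegral_congr fun u => ?_
  by_cases hu : u ∈ A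
  · have : Prod.mk u ⁻¹' R = Iio (⟨a u, ha0 u⟩ : Ioi (0 : ℝ)) := by
      ext r
      simp [hR, hu, ← Subtype.coe_lt_coe]
    rw [this, Measure.volumeIoiPow_apply_Iio, indicator_of_mem hu]
    have h1 : 1 ≤ n := Nat.one_le_iff_ne_zero.2 hn
    simp [finrank_euclideanSpace, Nat.sub_add_cancel h1, Nat.cast_sub h1]
  · have : Prod.mk u ⁻¹' R = ∅ := by
      ext r
      simp [hR, hu]
    rw [this, measure_empty, indicator_of_notMem hu]

/-- As `ψ (r u)` has length `r ‖ψ u‖` and the direction of `ψ u`, the bound `1` on its length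
becomes `r < ‖ψ u‖⁻¹`. -/
theorem preimage_radialRegion (A : Set (Sph n)) :
    ψ ⁻¹' radialRegion A (fun _ => 1)
      = radialRegion (directionHomeomorph ψ ⁻¹' A) (fun u => ‖ψ u‖⁻¹) := by
  ext x
  constructor
  · rintro ⟨v, hv, r, hr, hr1, hx⟩
    obtain ⟨u, rfl⟩ := (directionHomeomorph ψ).surjective v
    have h := norm_map_sphere_pos ψ u
    refine ⟨u, hv, r * ‖ψ u‖⁻¹, by positivity, ?_, ψ.injective ?_⟩
    · exact mul_lt_of_lt_one_left (by positivity) hr1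
    · rw [hx, map_smul, coe_directionHomeomorph, smul_smul]
  · rintro ⟨u, hu, r, hr, hr1, rfl⟩
    have h := norm_map_sphere_pos ψ u
    refine ⟨directionHomeomorph ψ u, hu, r * ‖ψ u‖, by positivity, ?_, ?_⟩
    · rwa [← lt_inv_mul_iff₀' h, mul_one]
    · rw [map_smul, coe_directionHomeomorph, smul_smul, mul_assoc, mul_inv_cancel₀ h.ne', mul_one]

/-- The Jacobian of the map of the sphere induced by `ψ`. -/
noncomputable def sphereJacobian (u : Sph n) : ℝ :=
  |LinearMap.det (ψ : Rn n →ₗ[ℝ] Rn n)| * (‖ψ u‖ ^ n)⁻¹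

theorem abs_det_pos : 0 < |LinearMap.det (ψ : Rn n →ₗ[ℝ] Rn n)| :=
  abs_pos.2 (LinearEquiv.isUnit_det' ψ).ne_zero

theorem measurable_sphereJacobian : Measurable (sphereJacobian ψ) :=
  ((measurable_norm_map_sphere ψ).pow_const n).inv.const_mul _

theorem sphereJacobian_pos (u : Sph n) : 0 < sphereJacobian ψ u :=
  mul_pos (abs_det_pos ψ) (inv_pos.2 (pow_pos (norm_map_sphere_pos ψ u) n))

/-- Compute the volume of the `ψ`-preimage of the unit cone over `A` twice. Linearity gives `|det
ψ|⁻¹ σ(A) / n`; polar coordinates give the integral of `‖ψ u‖⁻ⁿ / n` over the directions sent into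
`A`. -/
theorem map_withDensity_sphereJacobian :
    ((sigma n).withDensity fun u => ENNReal.ofReal (sphereJacobian ψ u)).map
      (directionHomeomorph ψ) = sigma n := by
  rcases eq_or_ne n 0 with rfl | hn
  · have : IsEmpty (Sph 0) := ⟨fun u => coe_sphere_ne_zero u (Subsingleton.elim _ _)⟩
    exact Subsingleton.elim _ _
  ext A hA
  have hT : Measurable (directionHomeomorph ψ) := (directionHomeomorph ψ).measurable
  have hn' : (n : ℝ≥0∞) ≠ 0 := by simpa using hn
  have hd := abs_det_pos ψ
  have h1 := volume_radialRegion hn hA (a := fun _ => 1) measurable_const fun _ => one_pos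
  have h2 := volume_radialRegion hn (hT hA) (a := fun u => ‖ψ u‖⁻¹)
    (measurable_norm_map_sphere ψ).inv fun u => inv_pos.2 (norm_map_sphere_pos ψ u)
  have h3 : volume (ψ ⁻¹' radialRegion A fun _ => 1)
      = ENNReal.ofReal |(LinearMap.det (ψ : Rn n →ₗ[ℝ] Rn n))⁻¹|
        * volume (radialRegion A fun _ => 1) :=
    Measure.addHaar_preimage_linearMap volume (LinearEquiv.isUnit_det' ψ).ne_zero _
  rw [preimage_radialRegion] at h3
  simp only [one_pow, lintegral_const, Measure.restrict_apply_univ] at h1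
  have h2' : ENNReal.ofReal (|LinearMap.det (ψ : Rn n →ₗ[ℝ] Rn n)| * n)
      * volume (radialRegion (directionHomeomorph ψ ⁻¹' A) fun u => ‖ψ u‖⁻¹)
      = ∫⁻ u in directionHomeomorph ψ ⁻¹' A, ENNReal.ofReal (sphereJacobian ψ u) ∂(sigma n) := by
    rw [h2, ← lintegral_const_mul' _ _ ENNReal.ofReal_ne_top]
    refine lintegral_congr fun u => ?_
    rw [← ENNReal.ofReal_mul (by positivity)]
    congr 1
    rw [sphereJacobian, inv_pow]
    field_simp
  rw [Measure.map_apply hT hA, withDensity_apply _ (hT hA), ← h2', h3, h1, ← mul_assoc,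
    ← mul_assoc, ← ENNReal.ofReal_mul (by positivity), ← ENNReal.ofReal_mul (by positivity),
    abs_inv]
  rw [show |LinearMap.det (ψ : Rn n →ₗ[ℝ] Rn n)| * n
    * |LinearMap.det (ψ : Rn n →ₗ[ℝ] Rn n)|⁻¹ * (1 / n) = 1 by field_simp]
  simp

/-- `F` may be arbitrary because the substitution is a measurable equivalence and the density is
finite; integrands built from the bodies then need no measurability proof. -/
theorem lintegral_sigma_eq (F : Sph n → ℝ≥0∞) :
    ∫⁻ v, F v ∂(sigma n)
      = ∫⁻ u, ENNReal.ofReal (sphereJacobian ψ u) * F (directionHomeomorph ψ u) ∂(sigma n) := by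
  conv_lhs => rw [← map_withDensity_sphereJacobian ψ]
  have := lintegral_map_equiv (μ := (sigma n).withDensity fun u =>
    ENNReal.ofReal (sphereJacobian ψ u)) F (directionHomeomorph ψ).toMeasurableEquiv
  rw [Homeomorph.toMeasurableEquiv_coe] at this
  rw [this, lintegral_withDensity_eq_lintegral_mul_non_measurable _
    (measurable_sphereJacobian ψ).ennreal_ofReal (.of_forall fun _ => ENNReal.ofReal_lt_top)]
  rfl

end SphereMap

/-! ### Linear images: polars, support functions, curvature functions -/

section LinearImages

variable {n : ℕ} (φ : Rn n ≃ₗ[ℝ] Rn n)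

/-- The contragredient `φ⁻ᵀ` of an invertible linear map. -/
noncomputable def contragredient : Rn n ≃ₗ[ℝ] Rn n :=
  LinearEquiv.ofLinearMap (LinearMap.adjoint (φ.symm : Rn n →ₗ[ℝ] Rn n))
    (LinearMap.adjoint (φ : Rn n →ₗ[ℝ] Rn n))
    (by rw [← LinearMap.adjoint_comp]; simp)
    (by rw [← LinearMap.adjoint_comp]; simp)

theorem contragredient_apply (x : Rn n) :
    contragredient φ x = LinearMap.adjoint (φ.symm : Rn n →ₗ[ℝ] Rn n) x := rfl

theorem adjoint_contragredient (x : Rn n) :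
    LinearMap.adjoint (φ : Rn n →ₗ[ℝ] Rn n) (contragredient φ x) = x :=
  (contragredient φ).symm_apply_apply x

theorem inner_contragredient (x y : Rn n) :
    inner ℝ (contragredient φ x) (φ y) = inner ℝ x y := by
  rw [contragredient_apply, LinearMap.adjoint_inner_left]
  simp

theorem det_adjoint (f : Rn n →ₗ[ℝ] Rn n) :
    LinearMap.det (LinearMap.adjoint f) = LinearMap.det f := by
  let b := EuclideanSpace.basisFun (Fin n) ℝ
  rw [← LinearMap.det_toMatrix b.toBasis, ← LinearMap.det_toMatrix b.toBasis f,
    LinearMap.toMatrix_adjoint, Matrix.det_conjTranspose, star_trivial]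

theorem det_contragredient :
    LinearMap.det (contragredient φ : Rn n →ₗ[ℝ] Rn n)
      = (LinearMap.det (φ : Rn n →ₗ[ℝ] Rn n))⁻¹ := by
  have : (contragredient φ : Rn n →ₗ[ℝ] Rn n)
      = LinearMap.adjoint (φ.symm : Rn n →ₗ[ℝ] Rn n) := rfl
  rw [this, det_adjoint, LinearEquiv.det_coe_symm]

theorem volume_image (A : Set (Rn n)) :
    volume (φ '' A) = ENNReal.ofReal |LinearMap.det (φ : Rn n →ₗ[ℝ] Rn n)| * volume A :=
  Measure.addHaar_image_linearMap volume (φ : Rn n →ₗ[ℝ] Rn n) A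

theorem polar_image (A : Set (Rn n)) : polar (φ '' A) = contragredient φ '' polar A := by
  ext x
  constructor
  · intro hx
    refine ⟨(contragredient φ).symm x, fun y hy => ?_, by simp⟩
    rw [← inner_contragredient φ, LinearEquiv.apply_symm_apply]
    exact hx _ (mem_image_of_mem _ hy)
  · rintro ⟨x, hx, rfl⟩ _ ⟨y, hy, rfl⟩
    rw [inner_contragredient]
    exact hx y hy

theorem image_mem_KZero {A : Set (Rn n)} (hA : A ∈ KZero n) : φ '' A ∈ KZero n := by
  refine ⟨hA.1.image (continuous_linearEquiv φ), hA.2.1.linear_image (φ : Rn n →ₗ[ℝ] Rn n), ?_⟩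
  have h := φ.toContinuousLinearEquiv.toHomeomorph.image_interior A
  change φ '' interior A = interior (φ '' A) at h
  rw [← h]
  exact ⟨0, hA.2.2, map_zero φ⟩

theorem image_mem_KZero_iff {A : Set (Rn n)} : φ '' A ∈ KZero n ↔ A ∈ KZero n := by
  refine ⟨fun h => ?_, image_mem_KZero φ⟩
  have := image_mem_KZero φ.symm h
  simpa [image_image] using this

/-- From `h_{φA}(x) = h_A(φᵀx)`, the choice `x = φ⁻ᵀu` returns `h_A(u)`; normalizing `x` costs one
factor by homogeneity. -/
theorem supportFun_image_direction (A : Set (Rn n)) (u : Sph n) :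
    supportFun (φ '' A) (directionHomeomorph (contragredient φ) u)
      = ‖contragredient φ u‖⁻¹ * supportFun A u := by
  rw [coe_directionHomeomorph, supportFun_smul_vec _ (by positivity)]
  have := supportFun_image (φ : Rn n →ₗ[ℝ] Rn n) A (contragredient φ u)
  rw [adjoint_contragredient] at this
  rw [← this]
  rfl

theorem radialFun_image_direction (A : Set (Rn n)) (u : Sph n) :
    radialFun (φ '' A) (directionHomeomorph φ u) = ‖φ u‖ * radialFun A u := by
  have h := norm_map_sphere_pos φ u
  have hset : {t : ℝ | 0 ≤ t ∧ t • (directionHomeomorph φ u : Rn n) ∈ φ '' A}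
      = ‖φ u‖ • {t : ℝ | 0 ≤ t ∧ t • (u : Rn n) ∈ A} := by
    ext t
    rw [mem_smul_set_iff_inv_smul_mem₀ h.ne']
    simp only [mem_ofPred_eq, smul_eq_mul, coe_directionHomeomorph, smul_smul, ← map_smul,
      φ.injective.mem_set_image, mul_comm t]
    rw [mul_nonneg_iff_of_pos_left (inv_pos.2 h)]
  rw [radialFun, hset, Real.sSup_smul_of_nonneg h.le, smul_eq_mul, radialFun]

/-- The surface area measure of `φ K` in terms of the surface area measure `S` of `K`. -/
noncomputable def transportedMeasure (S : Measure (Sph n)) : Measure (Sph n) :=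
  (S.withDensity fun u => ENNReal.ofReal
    (|LinearMap.det (φ : Rn n →ₗ[ℝ] Rn n)| * ‖contragredient φ u‖)).map
      (directionHomeomorph (contragredient φ))

theorem isFiniteMeasure_transportedMeasure (S : Measure (Sph n)) [IsFiniteMeasure S] :
    IsFiniteMeasure (transportedMeasure φ S) := by
  have hint : Integrable (fun u : Sph n =>
      |LinearMap.det (φ : Rn n →ₗ[ℝ] Rn n)| * ‖contragredient φ u‖) S :=
    (((continuous_linearEquiv (contragredient φ)).comp
      continuous_subtype_val).norm.const_mul _).integrable_of_hasCompactSupport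
      (HasCompactSupport.of_compactSpace _)
  have := isFiniteMeasure_withDensity_ofReal hint.2
  unfold transportedMeasure
  infer_instance

/-- The weight `‖φ⁻ᵀu‖` in the transported measure cancels the normalizing factor of the support
function. -/
theorem integral_supportFun_transportedMeasure (S : Measure (Sph n)) (L : Set (Rn n)) :
    ∫ u : Sph n, supportFun L u ∂(transportedMeasure φ S)
      = |LinearMap.det (φ : Rn n →ₗ[ℝ] Rn n)|
        * ∫ u : Sph n, supportFun (φ.symm '' L) u ∂S := by
  have hmap := integral_map_equiv (μ := S.withDensity fun u => ENNReal.ofReal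
    (|LinearMap.det (φ : Rn n →ₗ[ℝ] Rn n)| * ‖contragredient φ u‖))
    (directionHomeomorph (contragredient φ)).toMeasurableEquiv (fun u : Sph n => supportFun L u)
  rw [Homeomorph.toMeasurableEquiv_coe] at hmap
  rw [transportedMeasure, hmap, integral_withDensity_eq_integral_toReal_smul
    ((measurable_norm_map_sphere _).const_mul _).ennreal_ofReal
    (.of_forall fun _ => ENNReal.ofReal_lt_top), ← integral_const_mul]
  refine integral_congr_ae (.of_forall fun u => ?_)
  have h := norm_map_sphere_pos (contragredient φ) u
  have hL : L = φ '' (φ.symm '' L) := by simp [image_image]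
  have hs := supportFun_image_direction φ (φ.symm '' L) u
  rw [← hL] at hs
  simp only [smul_eq_mul]
  rw [hs, ENNReal.toReal_ofReal (by positivity)]
  field_simp

/-- Since `φK + εL = φ(K + ε φ⁻¹L)`, the difference quotient for `φK` and `L` is `|det φ|` times
that for `K` and `φ⁻¹L`. -/
theorem IsSurfaceAreaMeasure.image {K : Set (Rn n)} {S : Measure (Sph n)}
    (hS : IsSurfaceAreaMeasure K S) :
    IsSurfaceAreaMeasure (φ '' K) (transportedMeasure φ S) := by
  have := hS.1
  refine ⟨isFiniteMeasure_transportedMeasure φ S, fun L hL => ?_⟩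
  rw [integral_supportFun_transportedMeasure]
  have h := (hS.2 _ (image_mem_KZero φ.symm hL)).const_mul
    |LinearMap.det (φ : Rn n →ₗ[ℝ] Rn n)|
  refine h.congr fun ε => ?_
  have hsum : φ '' K + ε • L = φ '' (K + ε • (φ.symm '' L)) := by
    rw [image_add, image_smul_set, image_image]
    simp
  rw [hsum, measureReal_def, measureReal_def, measureReal_def, measureReal_def, volume_image,
    volume_image, ENNReal.toReal_mul, ENNReal.toReal_mul, ENNReal.toReal_ofReal (abs_nonneg _)]
  ring

/-- The factor by which the curvature function changes under `φ`. -/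
noncomputable def curvatureFactor (u : Sph n) : ℝ :=
  LinearMap.det (φ : Rn n →ₗ[ℝ] Rn n) ^ 2 * ‖contragredient φ u‖ ^ (n + 1)

/-- This explains the exponents in `curvatureFactor`: after absorbing the Jacobian `|det φ|⁻¹
‖φ⁻ᵀu‖⁻ⁿ`, the weight of the transported measure must remain. -/
theorem sphereJacobian_mul_curvatureFactor (u : Sph n) :
    sphereJacobian (contragredient φ) u * curvatureFactor φ u
      = |LinearMap.det (φ : Rn n →ₗ[ℝ] Rn n)| * ‖contragredient φ u‖ := by
  have h := norm_map_sphere_pos (contragredient φ) u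
  have hd := abs_det_pos φ
  rw [sphereJacobian, curvatureFactor, det_contragredient, abs_inv, ← sq_abs, pow_succ ‖_‖]
  field_simp

theorem transportedMeasure_withDensity {f : Sph n → ℝ≥0∞} (hf : Measurable f) :
    transportedMeasure φ ((sigma n).withDensity f)
      = (sigma n).withDensity fun v =>
        ENNReal.ofReal (curvatureFactor φ ((directionHomeomorph (contragredient φ)).symm v))
          * f ((directionHomeomorph (contragredient φ)).symm v) := by
  ext A hA
  set T := directionHomeomorph (contragredient φ) with hT
  have hTA : MeasurableSet (T ⁻¹' A) := T.measurable hA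
  have hg : Measurable fun u : Sph n => ENNReal.ofReal
      (|LinearMap.det (φ : Rn n →ₗ[ℝ] Rn n)| * ‖contragredient φ u‖) :=
    ((measurable_norm_map_sphere _).const_mul _).ennreal_ofReal
  rw [transportedMeasure, Measure.map_apply T.measurable hA, ← withDensity_mul _ hf hg,
    withDensity_apply _ hTA, withDensity_apply _ hA, ← lintegral_indicator hA,
    ← lintegral_indicator hTA, lintegral_sigma_eq (contragredient φ) (A.indicator _)]
  refine lintegral_congr fun u => ?_
  rw [← hT]
  by_cases hu : T u ∈ A
  · rw [indicator_of_mem (show u ∈ T ⁻¹' A from hu), indicator_of_mem hu, Pi.mul_apply,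
      Homeomorph.symm_apply_apply, ← mul_assoc,
      ← ENNReal.ofReal_mul (sphereJacobian_pos _ u).le, sphereJacobian_mul_curvatureFactor,
      mul_comm]
  · rw [indicator_of_notMem (show u ∉ T ⁻¹' A from hu), indicator_of_notMem hu, mul_zero]

theorem image_mem_FZero {K : Set (Rn n)} (hK : K ∈ FZero n) : φ '' K ∈ FZero n := by
  obtain ⟨hK0, S, hS, hac⟩ := hK
  have := hS.1
  have := Measure.haveLebesgueDecomposition_of_sigmaFinite S (sigma n)
  refine ⟨image_mem_KZero φ hK0, transportedMeasure φ S, hS.image φ, ?_⟩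
  rw [← Measure.withDensity_rnDeriv_eq S _ hac,
    transportedMeasure_withDensity φ (Measure.measurable_rnDeriv _ _)]
  exact withDensity_absolutelyContinuous _ _

/-- Radon–Nikodym derivatives are determined only almost everywhere, which suffices under the
integrals. -/
theorem curvatureFun_image_ae {K : Set (Rn n)} (hK : K ∈ FZero n) :
    ∀ᵐ v ∂(sigma n), curvatureFun (φ '' K) v
      = curvatureFactor φ ((directionHomeomorph (contragredient φ)).symm v)
        * curvatureFun K ((directionHomeomorph (contragredient φ)).symm v) := by
  obtain ⟨hK0, S, hS, hac⟩ := hK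
  have := hS.1
  have := Measure.haveLebesgueDecomposition_of_sigmaFinite S (sigma n)
  have hm : Measurable (S.rnDeriv (sigma n)) := Measure.measurable_rnDeriv _ _
  have hTm := (directionHomeomorph (contragredient φ)).symm.measurable
  have hcm : Measurable (curvatureFactor φ) :=
    ((measurable_norm_map_sphere _).pow_const _).const_mul _
  have h := Measure.rnDeriv_withDensity (sigma n)
    ((hcm.comp hTm).ennreal_ofReal.mul (hm.comp hTm))
  have h2 := transportedMeasure_withDensity φ hm
  rw [Measure.withDensity_rnDeriv_eq S _ hac] at h2
  unfold curvatureFun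
  rw [(hS.image φ).surfaceAreaMeasure_eq, hS.surfaceAreaMeasure_eq, h2]
  filter_upwards [h] with v hv
  have hc : 0 ≤ curvatureFactor φ ((directionHomeomorph (contragredient φ)).symm v) := by
    unfold curvatureFactor; positivity
  refine (congrArg ENNReal.toReal hv).trans ?_
  simp [ENNReal.toReal_mul, ENNReal.toReal_ofReal hc]

end LinearImages

/-! ### Scaling of mixed and dual mixed volumes -/

section Functionals

variable {n : ℕ} (φ : Rn n ≃ₗ[ℝ] Rn n)

theorem curvatureFun_nonneg (K : Set (Rn n)) (u : Sph n) : 0 ≤ curvatureFun K u :=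
  ENNReal.toReal_nonneg

/-- Geometric means of densities that scale by `det φ ^ 2 ‖φ⁻ᵀ u‖ ^ n` have integrals that scale
by `|det φ|`. -/
theorem lintegral_geom_mean_image (hn : n ≠ 0) {g g' : Fin n → Sph n → ℝ}
    (hg : ∀ i u, 0 ≤ g i u)
    (h : ∀ i, ∀ᵐ v ∂(sigma n), g' i v = LinearMap.det (φ : Rn n →ₗ[ℝ] Rn n) ^ 2
      * ‖contragredient φ ((directionHomeomorph (contragredient φ)).symm v)‖ ^ n
      * g i ((directionHomeomorph (contragredient φ)).symm v)) :
    ∫⁻ v, ENNReal.ofReal (∏ i, g' i v ^ (1 / (n : ℝ))) ∂(sigma n)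
      = ENNReal.ofReal |LinearMap.det (φ : Rn n →ₗ[ℝ] Rn n)|
        * ∫⁻ u, ENNReal.ofReal (∏ i, g i u ^ (1 / (n : ℝ))) ∂(sigma n) := by
  have hd := abs_det_pos φ
  rw [← lintegral_const_mul' _ _ ENNReal.ofReal_ne_top]
  calc
    _ = ∫⁻ v, ENNReal.ofReal (∏ i, (LinearMap.det (φ : Rn n →ₗ[ℝ] Rn n) ^ 2
      * ‖contragredient φ ((directionHomeomorph (contragredient φ)).symm v)‖ ^ n
      * g i ((directionHomeomorph (contragredient φ)).symm v)) ^ (1 / (n : ℝ))) ∂(sigma n) := by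
      refine lintegral_congr_ae ?_
      filter_upwards [ae_all_iff.2 h] with v hv
      simp only [hv]
    _ = _ := by
      rw [lintegral_sigma_eq (contragredient φ)]
      refine lintegral_congr fun u => ?_
      have hu := norm_map_sphere_pos (contragredient φ) u
      rw [← ENNReal.ofReal_mul (sphereJacobian_pos _ u).le, ← ENNReal.ofReal_mul hd.le]
      simp only [Homeomorph.symm_apply_apply]
      -- The `n` factors, each with exponent `1 / n`, release the common constant exactly once.
      have hprod : ∏ i, (LinearMap.det (φ : Rn n →ₗ[ℝ] Rn n) ^ 2
          * ‖contragredient φ u‖ ^ n * g i u) ^ (1 / (n : ℝ))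
          = LinearMap.det (φ : Rn n →ₗ[ℝ] Rn n) ^ 2 * ‖contragredient φ u‖ ^ n
            * ∏ i, g i u ^ (1 / (n : ℝ)) := by
        have hc : 0 ≤ LinearMap.det (φ : Rn n →ₗ[ℝ] Rn n) ^ 2 * ‖contragredient φ u‖ ^ n := by
          positivity
        simp_rw [Real.mul_rpow hc (hg _ u)]
        rw [Finset.prod_mul_distrib, Finset.prod_const, Finset.card_univ, Fintype.card_fin,
          one_div, Real.rpow_inv_natCast_pow hc hn]
      rw [hprod, sphereJacobian, det_contragredient, abs_inv, ← sq_abs (LinearMap.det _)]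
      congr 1
      field_simp

/-- The exponents `p` and `1 - p` of the two support functions add to one, so together they remove
one of the `n + 1` powers of `‖φ⁻ᵀu‖`, whatever `p` is. -/
theorem mixedVp_image (hn : n ≠ 0) {K L : Fin n → Set (Rn n)} (hK : ∀ i, K i ∈ FZero n)
    (hL : ∀ i, L i ∈ KZero n) (p : ℝ) :
    mixedVp p (fun i => φ '' K i) (fun i => φ '' L i)
      = ENNReal.ofReal |LinearMap.det (φ : Rn n →ₗ[ℝ] Rn n)| * mixedVp p K L := by
  unfold mixedVp
  rw [lintegral_geom_mean_image φ hn (g := fun i u =>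
    supportFun (L i) u ^ p * lpCurvatureFun p (K i) u) ?_ ?_, mul_left_comm]
  · intro i u
    exact mul_nonneg (Real.rpow_nonneg (supportFun_nonneg (hL i) _) _)
      (mul_nonneg (Real.rpow_nonneg (supportFun_nonneg (hK i).1 _) _) (curvatureFun_nonneg _ _))
  · intro i
    filter_upwards [curvatureFun_image_ae φ (hK i)] with v hv
    obtain ⟨u, rfl⟩ := (directionHomeomorph (contragredient φ)).surjective v
    rw [Homeomorph.symm_apply_apply] at hv ⊢
    have hu := norm_map_sphere_pos (contragredient φ) u
    rw [lpCurvatureFun, hv, supportFun_image_direction, supportFun_image_direction,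
      Real.mul_rpow (by positivity) (supportFun_nonneg (hL i) _),
      Real.mul_rpow (by positivity) (supportFun_nonneg (hK i).1 _), curvatureFactor,
      lpCurvatureFun]
    have hpow : (‖contragredient φ u‖⁻¹) ^ p * (‖contragredient φ u‖⁻¹) ^ (1 - p)
        * ‖contragredient φ u‖ = 1 := by
      rw [← Real.rpow_add (by positivity), add_sub_cancel, Real.rpow_one, inv_mul_cancel₀ hu.ne']
    rw [pow_succ]
    linear_combination (LinearMap.det (φ : Rn n →ₗ[ℝ] Rn n) ^ 2 * ‖contragredient φ u‖ ^ n
      * (supportFun (L i) u ^ p * (supportFun (K i) u ^ (1 - p) * curvatureFun (K i) u))) * hpow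

theorem geominimalZero_image (hn : n ≠ 0) {K : Fin n → Set (Rn n)} (hK : ∀ i, K i ∈ FZero n) :
    geominimalZero (fun i => φ '' K i)
      = ENNReal.ofReal |LinearMap.det (φ : Rn n →ₗ[ℝ] Rn n)| * geominimalZero K := by
  unfold geominimalZero
  rw [lintegral_geom_mean_image φ hn (g := fun i u =>
    curvatureFun (K i) u * supportFun (K i) u) ?_ ?_]
  · exact fun i u => mul_nonneg (curvatureFun_nonneg _ _) (supportFun_nonneg (hK i).1 _)
  · intro i
    filter_upwards [curvatureFun_image_ae φ (hK i)] with v hv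
    obtain ⟨u, rfl⟩ := (directionHomeomorph (contragredient φ)).surjective v
    rw [Homeomorph.symm_apply_apply] at hv ⊢
    have hu := norm_map_sphere_pos (contragredient φ) u
    rw [hv, supportFun_image_direction, curvatureFactor, pow_succ ‖_‖]
    field_simp

theorem volume_polar_image (L : Set (Rn n)) :
    volume (polar (φ '' L))
      = (ENNReal.ofReal |LinearMap.det (φ : Rn n →ₗ[ℝ] Rn n)|)⁻¹ * volume (polar L) := by
  rw [polar_image, volume_image, det_contragredient, abs_inv,
    ENNReal.ofReal_inv_of_pos (abs_det_pos φ)]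

/-- Each of the `n` radial functions gains a factor `‖φ⁻ᵀu‖`; their product cancels the power in the
Jacobian and leaves `|det φ|⁻¹`. -/
theorem dualMixedVolume_polar_image (L : Fin n → Set (Rn n)) :
    dualMixedVolume (fun i => polar (φ '' L i))
      = (ENNReal.ofReal |LinearMap.det (φ : Rn n →ₗ[ℝ] Rn n)|)⁻¹
        * dualMixedVolume fun i => polar (L i) := by
  have hd := abs_det_pos φ
  unfold dualMixedVolume
  rw [lintegral_sigma_eq (contragredient φ), mul_left_comm, ← ENNReal.ofReal_inv_of_pos hd,
    ← lintegral_const_mul' _ _ ENNReal.ofReal_ne_top]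
  congr 1
  refine lintegral_congr fun u => ?_
  have hu := norm_map_sphere_pos (contragredient φ) u
  rw [← ENNReal.ofReal_mul (sphereJacobian_pos _ u).le, ← ENNReal.ofReal_mul (by positivity)]
  simp only [polar_image, radialFun_image_direction]
  rw [Finset.prod_mul_distrib, Finset.prod_const, Finset.card_univ, Fintype.card_fin,
    sphereJacobian, det_contragredient, abs_inv]
  congr 1
  field_simp

end Functionals

/-! ### Constants in extended nonnegative powers, infima and suprema -/

section Scaling

/-- For negative exponents, multiplicativity fails only at `0 * ∞`, which a finite nonzero `c`
excludes even if `x` is `0` or `∞`. -/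
theorem mul_rpow_of_ne_zero_of_ne_top {c : ℝ≥0∞} (hc : c ≠ 0) (hc' : c ≠ ⊤) (x : ℝ≥0∞) (a : ℝ) :
    (c * x) ^ a = c ^ a * x ^ a := by
  simp [ENNReal.mul_rpow_eq_ite, hc, hc']

variable {X : Type*} {s : Set X} (e : X ≃ X) {F F' : X → ℝ≥0∞}
  {c : ℝ≥0∞}

/-- Reindex by `e`. For `x ∉ s` the inner infimum is `⊤`, and `c * ⊤ = ⊤` requires `c ≠ 0`. -/
theorem biInf_eq_mul_biInf (he : ∀ x, e x ∈ s ↔ x ∈ s) (hc : c ≠ 0) (hc' : c ≠ ⊤)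
    (h : ∀ x ∈ s, F' (e x) = c * F x) : ⨅ x ∈ s, F' x = c * ⨅ x ∈ s, F x := by
  rw [← e.iInf_comp, ENNReal.mul_iInf_of_ne hc hc']
  refine iInf_congr fun x => ?_
  rw [he, ENNReal.mul_iInf_of_ne hc hc']
  exact iInf_congr fun hx => h x hx

theorem biSup_eq_mul_biSup (he : ∀ x, e x ∈ s ↔ x ∈ s)
    (h : ∀ x ∈ s, F' (e x) = c * F x) : ⨆ x ∈ s, F' x = c * ⨆ x ∈ s, F x := by
  rw [← e.iSup_comp, ENNReal.mul_iSup]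
  refine iSup_congr fun x => ?_
  rw [he, ENNReal.mul_iSup]
  exact iSup_congr fun hx => h x hx

end Scaling

/-! ### Equivariance of the functionals and of their extremal values -/

section Geominimal

variable {n : ℕ} (φ : Rn n ≃ₗ[ℝ] Rn n) {K : Fin n → Set (Rn n)} {p : ℝ}

theorem ofReal_abs_det_ne_zero :
    ENNReal.ofReal |LinearMap.det (φ : Rn n →ₗ[ℝ] Rn n)| ≠ 0 := by
  simpa using (LinearEquiv.isUnit_det' φ).ne_zero

theorem rpow_mul_inv_rpow {D : ℝ≥0∞} (hD : D ≠ 0) (hD' : D ≠ ⊤) (a b c : ℝ) :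
    D ^ (a / c) * D⁻¹ ^ (b / c) = D ^ ((a - b) / c) := by
  rw [ENNReal.inv_rpow, ← ENNReal.rpow_neg, ← ENNReal.rpow_add _ _ hD hD']
  congr 1
  ring

/-- `V_p` contributes the exponent `n / (n + p)` of `|det φ|`, and the polar volume contributes `-p
/ (n + p)`. -/
theorem functionalOne_image (hn : n ≠ 0) (hK : ∀ i, K i ∈ FZero n) {L : Set (Rn n)}
    (hL : L ∈ KZero n) :
    functionalOne p (fun i => φ '' K i) (φ '' L)
      = ENNReal.ofReal |LinearMap.det (φ : Rn n →ₗ[ℝ] Rn n)| ^ ((n - p) / (n + p))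
        * functionalOne p K L := by
  have hD := ofReal_abs_det_ne_zero φ
  have hD' : ENNReal.ofReal |LinearMap.det (φ : Rn n →ₗ[ℝ] Rn n)| ≠ ⊤ := ENNReal.ofReal_ne_top
  unfold functionalOne
  rw [mixedVp_image φ hn hK (fun _ => hL), volume_polar_image,
    mul_rpow_of_ne_zero_of_ne_top hD hD',
    mul_rpow_of_ne_zero_of_ne_top (ENNReal.inv_ne_zero.2 hD') (ENNReal.inv_ne_top.2 hD),
    ← rpow_mul_inv_rpow hD hD']
  ring

theorem functionalTwo_image (hn : n ≠ 0) (hK : ∀ i, K i ∈ FZero n) {L : Fin n → Set (Rn n)}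
    (hL : ∀ i, L i ∈ KZero n) :
    functionalTwo p (fun i => φ '' K i) (fun i => φ '' L i)
      = ENNReal.ofReal |LinearMap.det (φ : Rn n →ₗ[ℝ] Rn n)| ^ ((n - p) / (n + p))
        * functionalTwo p K L := by
  have hD := ofReal_abs_det_ne_zero φ
  have hD' : ENNReal.ofReal |LinearMap.det (φ : Rn n →ₗ[ℝ] Rn n)| ≠ ⊤ := ENNReal.ofReal_ne_top
  have hn' : (n : ℝ) ≠ 0 := Nat.cast_ne_zero.2 hn
  unfold functionalTwo
  simp_rw [volume_polar_image,
    mul_rpow_of_ne_zero_of_ne_top (ENNReal.inv_ne_zero.2 hD') (ENNReal.inv_ne_top.2 hD)]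
  -- The `n` equal determinant factors turn the exponent `p / ((n + p) * n)` into `p / (n + p)`.
  rw [mixedVp_image φ hn hK hL, mul_rpow_of_ne_zero_of_ne_top hD hD', Finset.prod_mul_distrib,
    Finset.prod_const, Finset.card_univ, Fintype.card_fin, ← ENNReal.rpow_natCast,
    ← ENNReal.rpow_mul, ← div_div, div_mul_cancel₀ _ hn', ← rpow_mul_inv_rpow hD hD']
  ring

theorem functionalThree_image (hn : n ≠ 0) (hK : ∀ i, K i ∈ FZero n) {L : Fin n → Set (Rn n)}
    (hL : ∀ i, L i ∈ KZero n) :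
    functionalThree p (fun i => φ '' K i) (fun i => φ '' L i)
      = ENNReal.ofReal |LinearMap.det (φ : Rn n →ₗ[ℝ] Rn n)| ^ ((n - p) / (n + p))
        * functionalThree p K L := by
  have hD := ofReal_abs_det_ne_zero φ
  have hD' : ENNReal.ofReal |LinearMap.det (φ : Rn n →ₗ[ℝ] Rn n)| ≠ ⊤ := ENNReal.ofReal_ne_top
  unfold functionalThree
  rw [mixedVp_image φ hn hK hL, dualMixedVolume_polar_image,
    mul_rpow_of_ne_zero_of_ne_top hD hD',
    mul_rpow_of_ne_zero_of_ne_top (ENNReal.inv_ne_zero.2 hD') (ENNReal.inv_ne_top.2 hD),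
    ← rpow_mul_inv_rpow hD hD']
  ring

/-- The bijection `A ↦ φ A` of the subsets of `ℝⁿ`. -/
def imageEquiv : Set (Rn n) ≃ Set (Rn n) := Equiv.Set.congr φ.toEquiv

/-- The bijection `(L₁, …, L_n) ↦ (φ L₁, …, φ L_n)`. -/
def imageEquivPi : (Fin n → Set (Rn n)) ≃ (Fin n → Set (Rn n)) :=
  Equiv.piCongrRight fun _ => imageEquiv φ

theorem geominimal_image (hn : n ≠ 0) (hK : ∀ i, K i ∈ FZero n) (α : Fin 3) :
    geominimal α p (fun i => φ '' K i)
      = ENNReal.ofReal |LinearMap.det (φ : Rn n →ₗ[ℝ] Rn n)| ^ ((n - p) / (n + p))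
        * geominimal α p K := by
  have hc : ENNReal.ofReal |LinearMap.det (φ : Rn n →ₗ[ℝ] Rn n)| ^ ((n - p) / (n + p)) ≠ 0 :=
    (ENNReal.rpow_pos (pos_iff_ne_zero.2 (ofReal_abs_det_ne_zero φ)) ENNReal.ofReal_ne_top).ne'
  have hc' : ENNReal.ofReal |LinearMap.det (φ : Rn n →ₗ[ℝ] Rn n)| ^ ((n - p) / (n + p)) ≠ ⊤ :=
    ENNReal.rpow_ne_top_of_ne_zero (ofReal_abs_det_ne_zero φ) ENNReal.ofReal_ne_top
  have hzero : p = 0 → geominimalZero (fun i => φ '' K i)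
      = ENNReal.ofReal |LinearMap.det (φ : Rn n →ₗ[ℝ] Rn n)| ^ ((n - p) / (n + p))
        * geominimalZero K := by
    rintro rfl
    have hn' : (n : ℝ) ≠ 0 := Nat.cast_ne_zero.2 hn
    rw [geominimalZero_image φ hn hK, sub_zero, add_zero, div_self hn', ENNReal.rpow_one]
  have he : ∀ L, imageEquiv φ L ∈ KZero n ↔ L ∈ KZero n := fun L => image_mem_KZero_iff φ
  have he' : ∀ L, imageEquivPi φ L ∈ {L : Fin n → Set (Rn n) | ∀ i, L i ∈ KZero n}
      ↔ L ∈ {L : Fin n → Set (Rn n) | ∀ i, L i ∈ KZero n} := fun L =>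
    forall_congr' fun i => image_mem_KZero_iff φ
  have key : geominimalOne p (fun i => φ '' K i)
        = ENNReal.ofReal |LinearMap.det (φ : Rn n →ₗ[ℝ] Rn n)| ^ ((n - p) / (n + p))
          * geominimalOne p K
      ∧ geominimalTwo p (fun i => φ '' K i)
        = ENNReal.ofReal |LinearMap.det (φ : Rn n →ₗ[ℝ] Rn n)| ^ ((n - p) / (n + p))
          * geominimalTwo p K
      ∧ geominimalThree p (fun i => φ '' K i)
        = ENNReal.ofReal |LinearMap.det (φ : Rn n →ₗ[ℝ] Rn n)| ^ ((n - p) / (n + p))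
          * geominimalThree p K := by
    unfold geominimalOne geominimalTwo geominimalThree
    split_ifs with h0 hp
    · exact ⟨hzero h0, hzero h0, hzero h0⟩
    · exact ⟨biInf_eq_mul_biInf _ he hc hc' fun L hL => functionalOne_image φ hn hK hL,
        biInf_eq_mul_biInf _ he' hc hc' fun L hL => functionalTwo_image φ hn hK hL,
        biInf_eq_mul_biInf _ he' hc hc' fun L hL => functionalThree_image φ hn hK hL⟩
    · exact ⟨biSup_eq_mul_biSup _ he fun L hL => functionalOne_image φ hn hK hL,
        biSup_eq_mul_biSup _ he' fun L hL => functionalTwo_image φ hn hK hL,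
        biSup_eq_mul_biSup _ he' fun L hL => functionalThree_image φ hn hK hL⟩
  fin_cases α
  · exact key.1
  · exact key.2.1
  · exact key.2.2

end Geominimal

end LpGeominimal

theorem proposition4p1 (n : ℕ) (K : Fin n → Set (LpGeominimal.Rn n))
    (hK : ∀ i, K i ∈ LpGeominimal.FZero n) :
    (∀ (φ : LpGeominimal.Rn n ≃ₗ[ℝ] LpGeominimal.Rn n) (i : Fin n),
      φ '' K i ∈ LpGeominimal.FZero n) ∧
    (∀ (φ : LpGeominimal.Rn n ≃ₗ[ℝ] LpGeominimal.Rn n) (α : Fin 3) (p : ℝ), p ≠ -(n : ℝ) →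
      LpGeominimal.geominimal α p (fun i => φ '' K i) =
        ENNReal.ofReal
            (|LinearMap.det (φ : LpGeominimal.Rn n →ₗ[ℝ] LpGeominimal.Rn n)| ^
              (((n : ℝ) - p) / ((n : ℝ) + p))) *
          LpGeominimal.geominimal α p K) ∧
    (∀ (φ : LpGeominimal.Rn n ≃ₗ[ℝ] LpGeominimal.Rn n),
      LinearMap.det (φ : LpGeominimal.Rn n →ₗ[ℝ] LpGeominimal.Rn n) = 1 →
      ∀ (α : Fin 3) (p : ℝ), p ≠ -(n : ℝ) →
        LpGeominimal.geominimal α p (fun i => φ '' K i) = LpGeominimal.geominimal α p K) := by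
  have main : ∀ (φ : LpGeominimal.Rn n ≃ₗ[ℝ] LpGeominimal.Rn n) (α : Fin 3) (p : ℝ),
      LpGeominimal.geominimal α p (fun i => φ '' K i) =
        ENNReal.ofReal
            (|LinearMap.det (φ : LpGeominimal.Rn n →ₗ[ℝ] LpGeominimal.Rn n)| ^
              (((n : ℝ) - p) / ((n : ℝ) + p))) *
          LpGeominimal.geominimal α p K := by
    intro φ α p
    rcases eq_or_ne n 0 with rfl | hn
    -- In dimension zero the determinant is one and the family of bodies is empty, so both sides
    -- coincide.
    · have hdet : LinearMap.det (φ : LpGeominimal.Rn 0 →ₗ[ℝ] LpGeominimal.Rn 0) = 1 :=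
        LinearMap.det_eq_one_of_subsingleton _
      rw [hdet, Subsingleton.elim (fun i => φ '' K i) K]
      simp
    · rw [LpGeominimal.geominimal_image φ hn hK,
        ENNReal.ofReal_rpow_of_pos (LpGeominimal.abs_det_pos φ)]
  refine ⟨fun φ i => LpGeominimal.image_mem_FZero φ (hK i), fun φ α p _ => main φ α p,
    fun φ hφ α p _ => ?_⟩
  rw [main, hφ]
  simp
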